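/- **Theorem 1.1 (Divergence to the steepest direction).** Let $(X,d)$ be a proper, geodesic metric space that is $\delta$-hyperbolic for some $\delta\ge 0$, i.e. $(x|z)_p\ge\min\{(x|y)_p,(y|z)_p\}-\delta$ for all $p,x,y,z\in X$, where $(x|y)_p:=\frac12\{d(p,x)+d(p,y)-d(x,y)\}$ is the Gromov product. A ray is a map $\xi:[0,\infty)\to X$ with $d(\xi(s),\xi(t))=|s-t|$ for all $s,t\ge0$; the Gromov boundary $\partial X$ is the set of rays modulo the relation $\sup_{t\ge0}d(\xi(t),\zeta(t))<\infty$, and $\xi(\infty)\in\partial X$ denotes the class of $\xi$. Assume $\partial X\ne\emptyset$. The Gromov closure $\overline X=X\sqcup\partial X$ carries the following topology. Fix $p\in X$. A generalized ray from $p$ is a map $\xi:[0,\infty)\to X$ with $\xi(0)=p$ that is either a ray, or a unit speed geodesic on some $[0,l]$, $0\le l<\infty$, and constant on $[l,\infty)$, in which case $\xi(\infty):=\xi(l)$. The topology of $\overline X$ is the quotient topology, under $\xi\mapsto\xi(\infty)$, of the topology of uniform convergence on bounded intervals on the set of generalized rays from $p$. Let $f:X\to\mathbb R$ be $L$-Lipschitz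 for some $L>0$ and (weakly, geodesically) convex: any $x,y\in X$ are joined by some minimal geodesic $\gamma:[0,1]\to X$ (that is, $\gamma(0)=x$, $\gamma(1)=y$ and $d(\gamma(s),\gamma(t))=|s-t|\,d(x,y)$ for all $s,t\in[0,1]$) with $f(\gamma(s))\le(1-s)f(x)+sf(y)$ for all $s\in[0,1]$. For $v\in\partial X$ let $$\partial_\infty f(v):=\lim_{t\to\infty}\frac{f(\xi(t))}{t},\qquad \xi \text{ a ray with } \xi(\infty)=v,$$ be the asymptotic slope (this limit exists and does not depend on the choice of $\xi$). Assume that $\alpha:=-\inf_{v\in\partial X}\partial_\infty f(v)>0$. For $\tau>0$ and $x\in X$ let $$\mathsf J^f_\tau(x):=\operatorname*{arg\,min}_{y\in X}\Big\{f(y)+\frac{d(x,y)^2}{2\tau}\Big\}.$$ Then the following hold. (i) There is a unique $v_*\in\partial X$ with $\partial_\infty f(v_*)<0$. (ii) For every $\tau>0$, every $x_0\in X$ and every sequence with $x_k\in\mathsf J^f_\tau(x_{k-1})$ for all $k\ge1$, the sequence $(x_k)$ converges to $v_*$ in $\overline X$ (for every choice of the base point $p$). (iii) Moreover, for every such $\tau$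 and $(x_k)$ and every ray $\xi$ with $\xi(0)=x_0$ and $\xi(\infty)=v_*$, $$(\xi(t)|x_k)_{x_0}\ \ge\ k\sqrt\tau\,\Big\{\Big(\frac{\alpha^2}{4L}+\frac{\alpha^4}{16L^3}\Big)\sqrt\tau-2\sqrt{2L\delta}\Big\}$$ for all integers $k\ge0$ and all $t>0$ with $f(\xi(t))\le f(x_k)$. -/

import Mathlib

open Filter Topology
open scoped NNReal

namespace GromovHyp

/-- The Gromov product `(x|y)_p`. -/
noncomputable def gromovProduct {X : Type*} [MetricSpace X] (p x y : X) : ℝ :=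
  (dist p x + dist p y - dist x y) / 2

/-- The four-point condition `(x|z)_p ≥ min {(x|y)_p, (y|z)_p} - δ`. -/
def IsHyperbolic (X : Type*) [MetricSpace X] (δ : ℝ) : Prop :=
  ∀ p x y z : X,
    min (gromovProduct p x y) (gromovProduct p y z) - δ ≤ gromovProduct p x z

/-- A minimal geodesic from `x` to `y`, parametrized proportionally to arc length by `[0,1]`. -/
def IsGeodesic {X : Type*} [MetricSpace X] (γ : unitInterval → X) (x y : X) : Prop :=
  γ 0 = x ∧ γ 1 = y ∧ ∀ s t : unitInterval, dist (γ s) (γ t) = |(s : ℝ) - t| * dist x y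

/-- Any two points are joined by a minimal geodesic. -/
def IsGeodesicSpace (X : Type*) [MetricSpace X] : Prop :=
  ∀ x y : X, ∃ γ : unitInterval → X, IsGeodesic γ x y

/-- (Weak, geodesic) convexity: any two points are joined by some minimal geodesic along which
`f` lies below its chord. -/
def IsGeodesicallyConvex {X : Type*} [MetricSpace X] (f : X → ℝ) : Prop :=
  ∀ x y : X, ∃ γ : unitInterval → X, IsGeodesic γ x y ∧
    ∀ s : unitInterval, f (γ s) ≤ (1 - (s : ℝ)) * f x + s * f y

/-- A (unit speed) ray is an isometric embedding of `[0,∞)`. -/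
def Ray (X : Type*) [MetricSpace X] : Type _ :=
  {ξ : ℝ≥0 → X // Isometry ξ}

/-- Two rays are asymptotic if `sup_t d(ξ(t), ζ(t)) < ∞`. -/
def Asymptotic {X : Type*} [MetricSpace X] (ξ ζ : Ray X) : Prop :=
  BddAbove (Set.range fun t : ℝ≥0 => dist (ξ.1 t) (ζ.1 t))

theorem asymptotic_equivalence (X : Type*) [MetricSpace X] :
    Equivalence (Asymptotic (X := X)) where
  refl ξ := ⟨0, by rintro _ ⟨t, rfl⟩; simp⟩
  symm := by
    rintro ξ ζ ⟨C, hC⟩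
    refine ⟨C, ?_⟩
    rintro _ ⟨t, rfl⟩
    simpa [dist_comm] using hC ⟨t, rfl⟩
  trans := by
    rintro ξ ζ η ⟨C, hC⟩ ⟨D, hD⟩
    refine ⟨C + D, ?_⟩
    rintro _ ⟨t, rfl⟩
    exact (dist_triangle _ (ζ.1 t) _).trans (add_le_add (hC ⟨t, rfl⟩) (hD ⟨t, rfl⟩))

/-- The asymptoty relation as a setoid on rays. -/
def raySetoid (X : Type*) [MetricSpace X] : Setoid (Ray X) :=
  ⟨Asymptotic, asymptotic_equivalence X⟩

/-- The Gromov boundary `∂X`: asymptoty classes of rays. -/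
def GromovBoundary (X : Type*) [MetricSpace X] : Type _ :=
  Quotient (raySetoid X)

/-- The boundary point `ξ(∞)` represented by the ray `ξ`. -/
def Ray.atInfinity {X : Type*} [MetricSpace X] (ξ : Ray X) : GromovBoundary X :=
  Quotient.mk (raySetoid X) ξ

/-- The asymptotic slope `∂_∞ f(v) = lim_{t → ∞} f(ξ(t)) / t`, with values in the extended reals,
computed along a chosen ray `ξ` representing `v`. -/
noncomputable def asymptoticSlope {X : Type*} [MetricSpace X] (f : X → ℝ)
    (v : GromovBoundary X) : EReal :=
  limUnder atTop fun t : ℝ≥0 => ((f ((Quotient.out v).1 t) / t : ℝ) : EReal)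

/-- `c` is a unit speed geodesic on `[0,l]` and constant on `[l,∞)`. -/
def StopsAt {X : Type*} [MetricSpace X] (c : ℝ≥0 → X) (l : ℝ≥0) : Prop :=
  (∀ s t : ℝ≥0, s ≤ l → t ≤ l → dist (c s) (c t) = dist s t) ∧ ∀ t : ℝ≥0, l ≤ t → c t = c l

/-- The space of generalized rays issuing from `p`: rays, and unit speed geodesics of finite
length extended by a constant. As a subspace of `C(ℝ≥0, X)` with the compact-open topology it
carries the topology of uniform convergence on bounded intervals. -/
abbrev GeneralizedRay (X : Type*) [MetricSpace X] (p : X) : Type _ :=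
  {c : C(ℝ≥0, X) // c 0 = p ∧ (Isometry c ∨ ∃ l : ℝ≥0, StopsAt c l)}

/-- The underlying set `X ⊔ ∂X` of the Gromov closure; `p` is the base point used for its
topology. -/
def GromovClosure (X : Type*) [MetricSpace X] (_p : X) : Type _ :=
  X ⊕ GromovBoundary X

/-- A point of `X`, seen in the Gromov closure. -/
def GromovClosure.ofPoint {X : Type*} [MetricSpace X] (p x : X) : GromovClosure X p :=
  Sum.inl x

/-- A boundary point, seen in the Gromov closure. -/
def GromovClosure.ofBoundary {X : Type*} [MetricSpace X] (p : X) (v : GromovBoundary X) :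
    GromovClosure X p :=
  Sum.inr v

open Classical in
/-- The end `c(∞)` of a generalized ray: its class in `∂X` if `c` is a ray, and the point of `X`
at which it stops otherwise. -/
noncomputable def GeneralizedRay.endpoint {X : Type*} [MetricSpace X] {p : X}
    (c : GeneralizedRay X p) : GromovClosure X p :=
  if h : Isometry c.1 then GromovClosure.ofBoundary p (Ray.atInfinity ⟨c.1, h⟩)
  else GromovClosure.ofPoint p (c.1 (c.2.2.resolve_left h).choose)

/-- The topology of the Gromov closure: the quotient topology of the space of generalized rays
issuing from `p`, two of them being identified if they have the same end. -/
noncomputable instance gromovClosureTopology (X : Type*) [MetricSpace X] (p : X) : TopologicalSpace (GromovClosure X p) :=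
  TopologicalSpace.coinduced GeneralizedRay.endpoint inferInstance

/-- The proximal operator `J^f_τ(x) = argmin_y { f(y) + d(x,y)^2 / (2τ) }`. -/
def proximal {X : Type*} [MetricSpace X] (f : X → ℝ) (τ : ℝ) (x : X) : Set X :=
  {y : X | ∀ z : X, f y + dist x y ^ 2 / (2 * τ) ≤ f z + dist x z ^ 2 / (2 * τ)}

end GromovHyp

namespace GromovHyp

/-! ### Four-point inequalities and geodesics in hyperbolic spaces -/

section Metric

variable {X : Type*} [MetricSpace X] {δ : ℝ}

/-! Everything rests on `le_max_add_gromovProduct`. In a hyperbolic space a geodesic from `x` to `y`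
passes within `(x|y)_p + 2δ` of `p`. If `f` lies below its chord on it, the Lipschitz bound gives `f
p ≤ max (f x) (f y) + L ((x|y)_p + 2δ)`. So two points where `f` is very negative have a large
Gromov product seen from `p`.

Uniqueness in (i) follows because `f` tends to `-∞` along any ray of negative slope, so two such
rays are asymptotic. The infimum `-α` is therefore the slope at `v_*`. Moving a distance `ατ` almost
at slope `-α` bounds the value of each proximal step (`proximal_le`), and the Lipschitz bound
sharpens this to a decrease of `f` by a fixed amount (`proximal_decrease`). Hence `f (x k)` tends to
`-∞` linearly in `k`. The key inequality gives divergence of Gromov products, which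
`tendsto_ofPoint_ofBoundary` turns into (ii) by compactness. With `p = x 0` it also gives (iii),
where `le_of_gain_le_add` does the arithmetic. -/

theorem gromovProduct_nonneg (p x y : X) : 0 ≤ gromovProduct p x y := by
  unfold gromovProduct
  linarith [dist_triangle_left x y p]

theorem gromovProduct_comm (p x y : X) : gromovProduct p x y = gromovProduct p y x := by
  unfold gromovProduct
  rw [dist_comm x y]; ring

/-- The base point distances cancel in the product inequality, which leaves a comparison of the
three ways to pair four points. -/
theorem IsHyperbolic.dist_add_dist_le (h : IsHyperbolic X δ) (p x y z : X) :
    dist p z + dist x y ≤ max (dist p x + dist z y) (dist p y + dist x z) + 2 * δ := by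
  have := h p x z y
  unfold gromovProduct at this
  rcases min_choice ((dist p x + dist p z - dist x z) / 2)
    ((dist p z + dist p y - dist z y) / 2) with h1 | h1 <;> rw [h1] at this
  · linarith [le_max_right (dist p x + dist z y) (dist p y + dist x z)]
  · linarith [le_max_left (dist p x + dist z y) (dist p y + dist x z)]

/-- Points of `[x,y]` at the same distance from `x` are `2δ`-close. -/
theorem IsHyperbolic.dist_le_of_between (h : IsHyperbolic X δ) {x y z w : X}
    (hz : dist x z + dist z y = dist x y) (hw : dist x w + dist w y = dist x y)
    (hzw : dist x z = dist x w) : dist z w ≤ 2 * δ := by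
  have := h.dist_add_dist_le z x y w
  rw [dist_comm z x] at this
  rcases max_choice (dist x z + dist w y) (dist z y + dist x w) with h1 | h1 <;> rw [h1] at this <;>
    linarith

theorem IsHyperbolic.gromovProduct_ge_of_three (h : IsHyperbolic X δ) {p a b c d : X} {r : ℝ}
    (hab : r ≤ gromovProduct p a b) (hbc : r ≤ gromovProduct p b c)
    (hcd : r ≤ gromovProduct p c d) (hδ : 0 ≤ δ) : r - 2 * δ ≤ gromovProduct p a d := by
  have h1 := h p a b c
  have h2 := h p a c d
  have h3 : r - δ ≤ gromovProduct p a c := by linarith [le_min hab hbc]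
  have h4 := le_min h3 (show r - δ ≤ gromovProduct p c d by linarith)
  linarith

theorem IsGeodesic.dist_left {γ : unitInterval → X} {x y : X} (h : IsGeodesic γ x y)
    (s : unitInterval) : dist x (γ s) = s * dist x y := by
  have := h.2.2 0 s
  rw [h.1] at this
  simpa [abs_of_nonneg s.2.1] using this

theorem IsGeodesic.dist_right {γ : unitInterval → X} {x y : X} (h : IsGeodesic γ x y)
    (s : unitInterval) : dist (γ s) y = (1 - s) * dist x y := by
  have := h.2.2 s 1
  rw [h.2.1, abs_sub_comm] at this
  simpa [abs_of_nonneg (sub_nonneg.2 s.2.2)] using this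

/-- A point at distance `r` from `x` on a geodesic to `y` along which `f` lies below its chord. -/
theorem IsGeodesicallyConvex.exists_between {f : X → ℝ} (hf : IsGeodesicallyConvex f) {x y : X}
    {r : ℝ} (hr : 0 ≤ r) (hrd : r ≤ dist x y) :
    ∃ z, dist x z = r ∧ dist z y = dist x y - r ∧
      f z ≤ f x + r / dist x y * (f y - f x) := by
  obtain ⟨γ, hγ, hfγ⟩ := hf x y
  have hs : r / dist x y ∈ Set.Icc (0 : ℝ) 1 :=
    ⟨by positivity, div_le_one_of_le₀ hrd dist_nonneg⟩
  have hmul : r / dist x y * dist x y = r := by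
    rcases eq_or_ne (dist x y) 0 with h0 | h0
    · rw [h0] at hrd ⊢; simp; linarith
    · field_simp
  refine ⟨γ ⟨_, hs⟩, ?_, ?_, ?_⟩
  · rw [hγ.dist_left]; exact hmul
  · rw [hγ.dist_right, sub_mul, one_mul]; rw [hmul]
  · refine (hfγ _).trans_eq ?_
    simp only
    ring

/-! ### Convex Lipschitz functions, Gromov products and rays -/

variable {f : X → ℝ} {L : ℝ≥0}

theorem le_add_of_lipschitzWith (hLip : LipschitzWith L f) (x y : X) :
    f x ≤ f y + L * dist x y := by
  have := hLip.dist_le_mul x y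
  rw [Real.dist_eq] at this
  linarith [le_abs_self (f x - f y)]

/-- A convex Lipschitz function is almost quasi-convex with respect to Gromov products. -/
theorem le_max_add_gromovProduct (hhyp : IsHyperbolic X δ) (hLip : LipschitzWith L f)
    (hconv : IsGeodesicallyConvex f) (p x y : X) :
    f p ≤ max (f x) (f y) + L * (gromovProduct p x y + 2 * δ) := by
  -- The point `z` at distance `(p|y)_x` from `x` balances the two sums in the four-point
  -- inequality: both equal half the perimeter of the triangle `p x y`.
  have hr0 : 0 ≤ gromovProduct x p y := gromovProduct_nonneg _ _ _
  have hr1 : gromovProduct x p y ≤ dist x y := by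
    unfold gromovProduct
    linarith [dist_triangle x y p, dist_comm p y]
  obtain ⟨z, hxz, hzy, hfz⟩ := hconv.exists_between hr0 hr1
  have hs1 : gromovProduct x p y / dist x y ≤ 1 := div_le_one_of_le₀ hr1 dist_nonneg
  have hs0 : 0 ≤ gromovProduct x p y / dist x y := by positivity
  have hz : f z ≤ max (f x) (f y) := by
    refine hfz.trans ?_
    have h1 := le_max_left (f x) (f y)
    have h2 := le_max_right (f x) (f y)
    nlinarith
  have hd : dist p z ≤ gromovProduct p x y + 2 * δ := by
    have := hhyp.dist_add_dist_le p x y z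
    unfold gromovProduct at hxz hzy ⊢
    rw [dist_comm x p] at hxz hzy
    rcases max_choice (dist p x + dist z y) (dist p y + dist x z) with h1 | h1 <;>
      rw [h1] at this <;> linarith
  have := le_add_of_lipschitzWith hLip p z
  have := mul_le_mul_of_nonneg_left hd L.coe_nonneg
  linarith

theorem Ray.dist_eq (ξ : Ray X) (s t : ℝ≥0) : dist (ξ.1 s) (ξ.1 t) = |(s : ℝ) - t| := by
  rw [ξ.2.dist_eq, NNReal.dist_eq]

theorem Ray.dist_zero (ξ : Ray X) (t : ℝ≥0) : dist (ξ.1 0) (ξ.1 t) = t := by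
  rw [ξ.dist_eq]; simp

theorem Ray.dist_base_le (ξ : Ray X) (p : X) (t : ℝ≥0) :
    dist p (ξ.1 t) ≤ t + dist p (ξ.1 0) := by
  linarith [dist_triangle p (ξ.1 0) (ξ.1 t), ξ.dist_zero t]

theorem Ray.le_dist_base (ξ : Ray X) (p : X) (t : ℝ≥0) :
    t - dist p (ξ.1 0) ≤ dist p (ξ.1 t) := by
  linarith [dist_triangle_left (ξ.1 0) (ξ.1 t) p, ξ.dist_zero t]

theorem Ray.le_gromovProduct (ξ : Ray X) (p : X) {r t : ℝ≥0} (h : r ≤ t) :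
    r - dist p (ξ.1 0) ≤ gromovProduct p (ξ.1 r) (ξ.1 t) := by
  have h1 := ξ.le_dist_base p r
  have h2 := ξ.le_dist_base p t
  have h3 := ξ.dist_eq r t
  have h4 : (r : ℝ) ≤ t := by exact_mod_cast h
  rw [abs_of_nonpos (by linarith)] at h3
  unfold gromovProduct
  linarith

/-- Rays whose Gromov products grow at unit rate are asymptotic. -/
theorem asymptotic_of_le_gromovProduct {ξ ζ : Ray X} (p : X) (C : ℝ)
    (h : ∀ r : ℝ≥0, r - C ≤ gromovProduct p (ξ.1 r) (ζ.1 r)) : Asymptotic ξ ζ := by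
  refine ⟨dist p (ξ.1 0) + dist p (ζ.1 0) + 2 * C, ?_⟩
  rintro _ ⟨r, rfl⟩
  have h1 := h r
  have h2 := ξ.dist_base_le p r
  have h3 := ζ.dist_base_le p r
  unfold gromovProduct at h1
  dsimp only
  linarith

/-! ### Asymptotic slopes -/

theorem tendsto_const_div_nnreal (C : ℝ) : Tendsto (fun t : ℝ≥0 => C / (t : ℝ)) atTop (𝓝 0) :=
  tendsto_const_nhds.div_atTop (NNReal.tendsto_coe_atTop.2 tendsto_id)

/-- The limit is the supremum of `h s - C / s`: later values dominate each of these numbers, and the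
error `C / s` vanishes. -/
theorem exists_tendsto_of_almost_monotone {h : ℝ≥0 → ℝ} {C M : ℝ} (hC : 0 ≤ C)
    (hM : ∀ t, h t ≤ M) (hmono : ∀ s t : ℝ≥0, 0 < s → s ≤ t → h s ≤ h t + C / s) :
    ∃ l, Tendsto h atTop (𝓝 l) := by
  set S : Set ℝ := (fun s : ℝ≥0 => h s - C / s) '' Set.Ioi 0
  have hbdd : BddAbove S := by
    refine ⟨M, ?_⟩
    rintro _ ⟨s, -, rfl⟩
    have : 0 ≤ C / s := by positivity
    linarith [hM s]
  have hne : S.Nonempty := ⟨_, 1, Set.mem_Ioi.2 one_pos, rfl⟩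
  refine ⟨sSup S, tendsto_order.2 ⟨fun a ha => ?_, fun a ha => ?_⟩⟩
  · obtain ⟨_, ⟨s, hs, rfl⟩, has⟩ := exists_lt_of_lt_csSup hne ha
    filter_upwards [eventually_ge_atTop s] with t ht
    linarith [hmono s t hs ht]
  · have h1 : Tendsto (fun t : ℝ≥0 => sSup S + C / t) atTop (𝓝 (sSup S)) := by
      simpa using (tendsto_const_div_nnreal C).const_add (sSup S)
    filter_upwards [h1.eventually (gt_mem_nhds ha), eventually_gt_atTop 0] with t ht ht0
    have := le_csSup hbdd ⟨t, ht0, rfl⟩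
    dsimp only at this
    linarith

/-- For a convex function the difference quotient from the origin of the ray is monotone. Here
convexity holds only along some geodesic from `ξ 0` to `ξ t`, but this stays `2δ`-close to the ray,
so monotonicity holds up to `2δL / s`. -/
theorem exists_tendsto_slope (hδ : 0 ≤ δ) (hhyp : IsHyperbolic X δ) (hLip : LipschitzWith L f)
    (hconv : IsGeodesicallyConvex f) (ξ : Ray X) :
    ∃ l : ℝ, Tendsto (fun t : ℝ≥0 => f (ξ.1 t) / t) atTop (𝓝 l) := by
  have key : ∃ l : ℝ, Tendsto (fun t : ℝ≥0 => (f (ξ.1 t) - f (ξ.1 0)) / t) atTop (𝓝 l) := by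
    refine exists_tendsto_of_almost_monotone (C := L * (2 * δ)) (M := L) (by positivity) ?_ ?_
    · intro t
      refine div_le_of_le_mul₀ t.coe_nonneg L.coe_nonneg ?_
      have := le_add_of_lipschitzWith hLip (ξ.1 t) (ξ.1 0)
      rw [dist_comm, ξ.dist_zero] at this
      linarith
    · intro s t hs hst
      have hs' : (0 : ℝ) < s := by exact_mod_cast hs
      have hst' : (s : ℝ) ≤ t := by exact_mod_cast hst
      have ht' : (0 : ℝ) < t := hs'.trans_le hst'
      have hd := ξ.dist_zero t
      obtain ⟨z, hz1, hz2, hz⟩ :=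
        hconv.exists_between (x := ξ.1 0) (y := ξ.1 t) (r := s) hs'.le (by rwa [hd])
      have hw2 : dist (ξ.1 s) (ξ.1 t) = t - s := by
        rw [ξ.dist_eq, abs_sub_comm, abs_of_nonneg (by linarith)]
      have hzw : dist (ξ.1 s) z ≤ 2 * δ :=
        hhyp.dist_le_of_between (x := ξ.1 0) (y := ξ.1 t) (by rw [ξ.dist_zero, hw2, hd]; ring)
          (by rw [hz1, hz2]; ring) (by rw [ξ.dist_zero, hz1])
      have h1 := le_add_of_lipschitzWith hLip (ξ.1 s) z
      have h2 := mul_le_mul_of_nonneg_left hzw L.coe_nonneg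
      rw [hd] at hz
      have h3 : f (ξ.1 s) - f (ξ.1 0) ≤ s / t * (f (ξ.1 t) - f (ξ.1 0)) + L * (2 * δ) := by
        linarith
      calc (f (ξ.1 s) - f (ξ.1 0)) / s
          ≤ (s / t * (f (ξ.1 t) - f (ξ.1 0)) + L * (2 * δ)) / s := by gcongr
        _ = _ := by field_simp
  obtain ⟨l, hl⟩ := key
  refine ⟨l, ?_⟩
  have := hl.add (tendsto_const_div_nnreal (f (ξ.1 0)))
  rw [add_zero] at this
  refine this.congr fun t => ?_
  ring

theorem Asymptotic.tendsto_slope (hLip : LipschitzWith L f) {ξ ζ : Ray X} (h : Asymptotic ξ ζ)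
    {l : ℝ} (hl : Tendsto (fun t : ℝ≥0 => f (ξ.1 t) / t) atTop (𝓝 l)) :
    Tendsto (fun t : ℝ≥0 => f (ζ.1 t) / t) atTop (𝓝 l) := by
  obtain ⟨C, hC⟩ := h
  have hdiff : Tendsto (fun t : ℝ≥0 => (f (ζ.1 t) - f (ξ.1 t)) / t) atTop (𝓝 0) := by
    refine squeeze_zero_norm (fun t => ?_) (tendsto_const_div_nnreal (L * C))
    rw [norm_div, Real.norm_eq_abs, Real.norm_eq_abs, abs_of_nonneg t.coe_nonneg]
    refine div_le_div_of_nonneg_right ?_ t.coe_nonneg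
    have h1 := hLip.dist_le_mul (ζ.1 t) (ξ.1 t)
    rw [Real.dist_eq, dist_comm] at h1
    exact h1.trans (mul_le_mul_of_nonneg_left (hC ⟨t, rfl⟩) L.coe_nonneg)
  have := hl.add hdiff
  rw [add_zero] at this
  refine this.congr fun t => ?_
  ring

theorem exists_asymptoticSlope_eq (hδ : 0 ≤ δ) (hhyp : IsHyperbolic X δ)
    (hLip : LipschitzWith L f) (hconv : IsGeodesicallyConvex f) (v : GromovBoundary X) :
    ∃ l : ℝ, asymptoticSlope f v = l ∧ ∀ ξ : Ray X, ξ.atInfinity = v →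
      Tendsto (fun t : ℝ≥0 => f (ξ.1 t) / t) atTop (𝓝 l) := by
  obtain ⟨l, hl⟩ := exists_tendsto_slope hδ hhyp hLip hconv (Quotient.out v)
  refine ⟨l, ?_, fun ξ hξ => ?_⟩
  · exact ((continuous_coe_real_ereal.tendsto l).comp hl).limUnder_eq
  · have : Asymptotic (Quotient.out v) ξ :=
      Quotient.exact (s := raySetoid X) ((Quotient.out_eq v).trans hξ.symm)
    exact this.tendsto_slope hLip hl

theorem tendsto_atBot_of_slope_neg {ξ : Ray X} {l : ℝ} (hl0 : l < 0)
    (hl : Tendsto (fun t : ℝ≥0 => f (ξ.1 t) / t) atTop (𝓝 l)) :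
    Tendsto (fun t : ℝ≥0 => f (ξ.1 t)) atTop atBot := by
  have h1 : Tendsto (fun t : ℝ≥0 => (t : ℝ)) atTop atTop := NNReal.tendsto_coe_atTop.2 tendsto_id
  refine (hl.neg_mul_atTop hl0 h1).congr' ?_
  filter_upwards [eventually_gt_atTop 0] with t ht
  have : (t : ℝ) ≠ 0 := by exact_mod_cast ht.ne'
  field_simp

/-- Along two families on which `f` tends to `-∞`, the Gromov product tends to infinity. -/
theorem tendsto_gromovProduct_atTop (hhyp : IsHyperbolic X δ)
    (hL : 0 < L) (hLip : LipschitzWith L f) (hconv : IsGeodesicallyConvex f) (p : X)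
    {ι : Type*} {l : Filter ι} {u w : ι → X} (hu : Tendsto (fun i => f (u i)) l atBot)
    (hw : Tendsto (fun i => f (w i)) l atBot) :
    Tendsto (fun i => gromovProduct p (u i) (w i)) l atTop := by
  refine tendsto_atTop.2 fun b => ?_
  have hL' : (0 : ℝ) < L := by exact_mod_cast hL
  filter_upwards [tendsto_atBot.1 hu (f p - L * (b + 2 * δ)),
    tendsto_atBot.1 hw (f p - L * (b + 2 * δ))] with i h1 h2
  have h3 := le_max_add_gromovProduct hhyp hLip hconv p (u i) (w i)
  have h4 := max_le h1 h2
  have h5 : L * (b + 2 * δ) ≤ L * (gromovProduct p (u i) (w i) + 2 * δ) := by linarith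
  linarith [le_of_mul_le_mul_left h5 hL']

theorem asymptotic_of_tendsto_atBot (hδ : 0 ≤ δ) (hhyp : IsHyperbolic X δ)
    (hL : 0 < L) (hLip : LipschitzWith L f) (hconv : IsGeodesicallyConvex f) {ξ ζ : Ray X}
    (hξ : Tendsto (fun t : ℝ≥0 => f (ξ.1 t)) atTop atBot)
    (hζ : Tendsto (fun t : ℝ≥0 => f (ζ.1 t)) atTop atBot) : Asymptotic ξ ζ := by
  set p := ξ.1 0
  refine asymptotic_of_le_gromovProduct p (dist p (ζ.1 0) + 2 * δ) fun r => ?_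
  have hprod := tendsto_gromovProduct_atTop hhyp hL hLip hconv p hξ hζ
  obtain ⟨t, ht1, ht2⟩ :=
    ((tendsto_atTop.1 hprod r).and (eventually_ge_atTop r)).exists
  have h1 := ξ.le_gromovProduct p ht2
  have h2 := ζ.le_gromovProduct p ht2
  have h3 : dist p (ξ.1 0) = 0 := dist_self _
  have h0 : 0 ≤ dist p (ζ.1 0) := dist_nonneg
  rw [gromovProduct_comm] at h2
  have h4 : r - dist p (ζ.1 0) ≤ gromovProduct p (ξ.1 r) (ξ.1 t) := by linarith
  have h5 : r - dist p (ζ.1 0) ≤ gromovProduct p (ξ.1 t) (ζ.1 t) := by linarith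
  linarith [hhyp.gromovProduct_ge_of_three h4 h5 h2 hδ]

/-! ### Proximal sequences -/

/-- The competitor lies at distance `ατ` from `x` towards `ξ t`, on a geodesic of convexity whose
chord slope tends to `-α`. The radius `ατ` minimizes `-αr + r² / (2τ)`, with minimum `-α²τ / 2`. -/
theorem proximal_le (hconv : IsGeodesicallyConvex f) {ξ : Ray X} {α : ℝ} (hα : 0 < α)
    (hl : Tendsto (fun t : ℝ≥0 => f (ξ.1 t) / t) atTop (𝓝 (-α))) {τ : ℝ} (hτ : 0 < τ) {x y : X}
    (hy : y ∈ proximal f τ x) : f y + dist x y ^ 2 / (2 * τ) ≤ f x - α ^ 2 * τ / 2 := by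
  set D : ℝ≥0 → ℝ := fun t => dist x (ξ.1 t)
  have hcoe : Tendsto (fun t : ℝ≥0 => (t : ℝ)) atTop atTop := NNReal.tendsto_coe_atTop.2 tendsto_id
  have hDt : Tendsto (fun t : ℝ≥0 => D t / t) atTop (𝓝 1) := by
    have h1 := tendsto_const_div_nnreal (dist x (ξ.1 0))
    refine tendsto_of_tendsto_of_tendsto_of_le_of_le'
      (g := fun t : ℝ≥0 => 1 - dist x (ξ.1 0) / t) (h := fun t : ℝ≥0 => 1 + dist x (ξ.1 0) / t)
      (by simpa using h1.const_sub 1) (by simpa using h1.const_add 1) ?_ ?_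
    · filter_upwards [eventually_gt_atTop 0] with t ht
      have ht' : (0 : ℝ) < t := by exact_mod_cast ht
      rw [le_div_iff₀ ht', sub_mul, div_mul_cancel₀ _ ht'.ne', one_mul]
      exact ξ.le_dist_base x t
    · filter_upwards [eventually_gt_atTop 0] with t ht
      have ht' : (0 : ℝ) < t := by exact_mod_cast ht
      rw [div_le_iff₀ ht', add_mul, div_mul_cancel₀ _ ht'.ne', one_mul]
      exact ξ.dist_base_le x t
  have hDinf : Tendsto D atTop atTop := by
    refine tendsto_atTop_mono (fun t => ξ.le_dist_base x t) ?_
    exact tendsto_atTop_add_const_right _ _ hcoe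
  have hq : Tendsto (fun t : ℝ≥0 => (f (ξ.1 t) - f x) / D t) atTop (𝓝 (-α)) := by
    have h1 := (hl.sub (tendsto_const_div_nnreal (f x))).div hDt one_ne_zero
    rw [sub_zero, div_one] at h1
    refine h1.congr' ?_
    filter_upwards [eventually_gt_atTop 0] with t ht
    have ht' : (t : ℝ) ≠ 0 := by exact_mod_cast ht.ne'
    simp only [Pi.div_apply, ← sub_div]
    exact div_div_div_cancel_right₀ ht' _ _
  have hlim : Tendsto (fun t : ℝ≥0 => f x + α * τ * ((f (ξ.1 t) - f x) / D t)
      + (α * τ) ^ 2 / (2 * τ)) atTop (𝓝 (f x + α * τ * (-α) + (α * τ) ^ 2 / (2 * τ))) :=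
    ((hq.const_mul _).const_add _).add_const _
  have hval : f x + α * τ * (-α) + (α * τ) ^ 2 / (2 * τ) = f x - α ^ 2 * τ / 2 := by
    field_simp; ring
  rw [← hval]
  refine ge_of_tendsto hlim ?_
  filter_upwards [hDinf.eventually_ge_atTop (α * τ)] with t ht
  obtain ⟨z, hz1, -, hz⟩ := hconv.exists_between (by positivity) ht
  have := hy z
  rw [hz1] at this
  have h2 : α * τ / dist x (ξ.1 t) * (f (ξ.1 t) - f x)
      = α * τ * ((f (ξ.1 t) - f x) / D t) := by
    simp only [D]; ring
  linarith

/-- The gain of one proximal step: both the decrease of `f`, and `α ≤ L`. -/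
theorem proximal_decrease (hL : 0 < L) (hLip : LipschitzWith L f)
    {α τ : ℝ} (hα : 0 < α) (hτ : 0 < τ) {x y : X}
    (h : f y + dist x y ^ 2 / (2 * τ) ≤ f x - α ^ 2 * τ / 2) :
    f y ≤ f x - 2 * L * τ * (α ^ 2 / (4 * L) + α ^ 4 / (16 * (L : ℝ) ^ 3)) ∧ α ≤ L := by
  have hL' : (0 : ℝ) < L := by exact_mod_cast hL
  set d := dist x y
  have h1 : f x ≤ f y + L * d := le_add_of_lipschitzWith hLip x y
  have hd : 0 ≤ d := dist_nonneg
  -- This quadratic inequality in `d` yields both a lower bound on the step length, fed back into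
  -- `h` for the term in `α⁴`, and, by completing the square, `α ≤ L`.
  have h2 : d ^ 2 + α ^ 2 * τ ^ 2 ≤ 2 * L * τ * d := by
    have : d ^ 2 / (2 * τ) * (2 * τ) = d ^ 2 := by field_simp
    nlinarith
  have h3 : α ^ 2 * τ / (2 * L) ≤ d := by
    rw [div_le_iff₀ (by positivity)]
    have : τ * (α ^ 2 * τ) ≤ τ * (d * (2 * L)) := by nlinarith [sq_nonneg d]
    exact le_of_mul_le_mul_left this hτ
  refine ⟨?_, ?_⟩
  · have h4 : (α ^ 2 * τ / (2 * L)) ^ 2 / (2 * τ) ≤ d ^ 2 / (2 * τ) := by gcongr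
    have h5 : 2 * L * τ * (α ^ 2 / (4 * L) + α ^ 4 / (16 * (L : ℝ) ^ 3))
        = α ^ 2 * τ / 2 + (α ^ 2 * τ / (2 * L)) ^ 2 / (2 * τ) := by
      field_simp; ring
    linarith
  · have h6 : (α * τ) ^ 2 ≤ (L * τ) ^ 2 := by nlinarith [sq_nonneg (d - L * τ)]
    have h7 := le_of_abs_le (abs_le_of_sq_le_sq h6 (by positivity))
    exact le_of_mul_le_mul_right h7 hτ

/-- An error of `2δ` is absorbed by half of the gain, unless the lower bound is negative. -/
theorem le_of_gain_le_add {τ δ B K G : ℝ} {k : ℕ} (hL : 0 < L) (hτ : 0 < τ) (hδ : 0 ≤ δ)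
    (hB : 0 ≤ B) (hBL : 1 ≤ k → B ≤ L) (hG : 0 ≤ G)
    (hK : K = k * (2 * L * τ * B)) (h : K ≤ L * (G + 2 * δ)) :
    (k : ℝ) * √τ * (B * √τ - 2 * √(2 * L * δ)) ≤ G := by
  have hL' : (0 : ℝ) < L := by exact_mod_cast hL
  rcases Nat.eq_zero_or_pos k with rfl | hk
  · simpa using hG
  rcases le_total (B * √τ) (2 * √(2 * L * δ)) with hc | hc
  · exact (mul_nonpos_of_nonneg_of_nonpos (by positivity) (by linarith)).trans hG
  have hk' : (1 : ℝ) ≤ k := by exact_mod_cast hk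
  -- Here the lower bound is positive or zero, so `8Lδ ≤ B²τ ≤ LBτ`. Thus `2δ` is at most one of the
  -- `2k` copies of `Bτ` in the gain.
  have hsq : 8 * L * δ ≤ B ^ 2 * τ := by
    have := pow_le_pow_left₀ (by positivity) hc 2
    rw [mul_pow, mul_pow, Real.sq_sqrt hτ.le, Real.sq_sqrt (by positivity)] at this
    linarith
  have hδB : 2 * δ ≤ B * τ := by
    have h1 : B ^ 2 * τ ≤ L * (B * τ) := by
      have := mul_le_mul_of_nonneg_right (hBL hk) (show 0 ≤ B * τ by positivity)
      linarith
    have : L * (8 * δ) ≤ L * (B * τ) := by linarith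
    linarith [le_of_mul_le_mul_left this hL']
  have hG' : 2 * (k * (B * τ)) ≤ G + 2 * δ := by
    refine le_of_mul_le_mul_left ?_ hL'
    linarith
  have hs : 0 ≤ k * √τ * √(2 * L * δ) := by positivity
  have hBk : B * τ ≤ k * (B * τ) := le_mul_of_one_le_left (by positivity) hk'
  have hexp : (k : ℝ) * √τ * (B * √τ - 2 * √(2 * L * δ))
      = k * (B * τ) - 2 * (k * √τ * √(2 * L * δ)) := by
    linear_combination (k : ℝ) * B * Real.mul_self_sqrt hτ.le
  linarith

end Metric
-- Generalized rays and convergence in the Gromov closure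
section Closure

variable {X : Type*} [MetricSpace X]

theorem StopsAt.not_isometry {c : ℝ≥0 → X} {l : ℝ≥0} (h : StopsAt c l) : ¬ Isometry c := by
  intro hc
  have h1 := hc.injective (h.2 (l + 1) (by simp))
  simp at h1

/-- By symmetry the stopping time is unique, so `endpoint` does not depend on the time chosen in its
definition. -/
theorem StopsAt.le {c : ℝ≥0 → X} {l m : ℝ≥0} (hl : StopsAt c l) (hm : StopsAt c m) : m ≤ l := by
  by_contra! hlt
  have h1 := hm.1 l m hlt.le le_rfl
  rw [hl.2 m hlt.le, dist_self] at h1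
  exact hlt.ne (dist_eq_zero.1 h1.symm)

theorem GeneralizedRay.endpoint_of_stopsAt {p : X} (c : GeneralizedRay X p) {l : ℝ≥0}
    (h : StopsAt c.1 l) : c.endpoint = GromovClosure.ofPoint p (c.1 l) := by
  have hc : ¬ Isometry c.1 := h.not_isometry
  have hspec := (c.2.2.resolve_left hc).choose_spec
  rw [GeneralizedRay.endpoint, dif_neg hc, (hspec.le h).antisymm (h.le hspec)]

theorem GeneralizedRay.endpoint_of_isometry {p : X} (c : GeneralizedRay X p) (h : Isometry c.1) :
    c.endpoint = GromovClosure.ofBoundary p (Ray.atInfinity ⟨c.1, h⟩) :=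
  dif_pos h

/-- A geodesic from `p` to `x`, as a generalized ray. -/
theorem IsGeodesicSpace.exists_generalizedRay (hgeo : IsGeodesicSpace X) (p x : X) :
    ∃ c : GeneralizedRay X p, LipschitzWith 1 c.1 ∧ StopsAt c.1 (nndist p x) ∧
      c.1 (nndist p x) = x := by
  obtain ⟨γ, hγ⟩ := hgeo p x
  set D : ℝ := dist p x
  have hD : 0 ≤ D := dist_nonneg
  let q : ℝ≥0 → unitInterval := fun t => Set.projIcc 0 1 zero_le_one ((t : ℝ) / D)
  have hdist : ∀ s t, dist (γ (q s)) (γ (q t)) = |(q s : ℝ) - q t| * D := fun s t => hγ.2.2 _ _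
  have hlip : LipschitzWith 1 fun t => γ (q t) := by
    refine LipschitzWith.of_dist_le_mul fun s t => ?_
    rw [hdist, NNReal.coe_one, one_mul, NNReal.dist_eq]
    have h1 : |(q s : ℝ) - q t| ≤ |(s : ℝ) / D - t / D| := by
      have := (LipschitzWith.projIcc (zero_le_one' ℝ)).dist_le_mul ((s : ℝ) / D) (t / D)
      simpa [Subtype.dist_eq, Real.dist_eq] using this
    refine (mul_le_mul_of_nonneg_right h1 hD).trans ?_
    rcases hD.eq_or_lt with h0 | h0
    · rw [← h0]; simp
    · rw [← sub_div, abs_div, abs_of_pos h0, div_mul_cancel₀ _ h0.ne']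
  have hq : ∀ t : ℝ≥0, t ≤ nndist p x → (q t : ℝ) = t / D := fun t ht => by
    have ht' : (t : ℝ) ≤ D := by exact_mod_cast ht
    simp only [q]
    rw [Set.projIcc_of_mem zero_le_one ⟨by positivity, div_le_one_of_le₀ ht' hD⟩]
  have hmul : ∀ t : ℝ≥0, t ≤ nndist p x → (t : ℝ) / D * D = t := fun t ht => by
    have ht' : (t : ℝ) ≤ D := by exact_mod_cast ht
    rcases hD.eq_or_lt with h0 | h0
    · rw [← h0] at ht' ⊢
      simpa using ht'.antisymm' t.coe_nonneg
    · rw [div_mul_cancel₀ _ h0.ne']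
  have hend : ∀ t : ℝ≥0, nndist p x ≤ t → γ (q t) = x := fun t ht => by
    have ht' : D ≤ t := by exact_mod_cast ht
    have h1 := hγ.dist_right (q t)
    rw [← dist_eq_zero, h1]
    rcases hD.eq_or_lt with h0 | h0
    · exact mul_eq_zero_of_right _ h0.symm
    · simp only [q]
      rw [Set.projIcc_of_right_le zero_le_one ((one_le_div h0).2 ht')]
      simp
  have hgeod : StopsAt (fun t => γ (q t)) (nndist p x) := by
    refine ⟨fun s t hs ht => ?_, fun t ht => (hend t ht).trans (hend _ le_rfl).symm⟩
    dsimp only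
    rw [hdist, hq s hs, hq t ht, NNReal.dist_eq, ← abs_of_nonneg hD, ← abs_mul,
      abs_of_nonneg hD, sub_mul, hmul s hs, hmul t ht]
  have hzero : γ (q 0) = p := by
    have : q 0 = 0 := Subtype.ext (by simp [hq 0 zero_le])
    rw [this, hγ.1]
  exact ⟨⟨⟨fun t => γ (q t), hlip.continuous⟩, hzero, Or.inr ⟨_, hgeod⟩⟩, hlip, hgeod,
    hend _ le_rfl⟩

/-- Arzelà–Ascoli: values at time `t` stay in a closed ball, compact by properness, and the defining
conditions are closed under pointwise limits. -/
theorem isCompact_lipschitz_based [ProperSpace X] (p : X) :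
    IsCompact {c : C(ℝ≥0, X) | c 0 = p ∧ LipschitzWith 1 c} := by
  refine ArzelaAscoli.isCompact_of_equicontinuous _ ?_ ?_
  · have himage : ContinuousMap.toFun '' {c : C(ℝ≥0, X) | c 0 = p ∧ LipschitzWith 1 c}
        = {g : ℝ≥0 → X | g 0 = p ∧ ∀ s t, dist (g s) (g t) ≤ dist s t} := by
      ext g
      constructor
      · rintro ⟨c, ⟨h0, hc⟩, rfl⟩
        exact ⟨h0, fun s t => by simpa using hc.dist_le_mul s t⟩
      · rintro ⟨h0, hg⟩
        have hg' : LipschitzWith 1 g :=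
          LipschitzWith.of_dist_le_mul fun s t => by simpa using hg s t
        exact ⟨⟨g, hg'.continuous⟩, ⟨h0, hg'⟩, rfl⟩
    rw [himage]
    refine (isCompact_univ_pi fun t : ℝ≥0 => isCompact_closedBall p (t : ℝ)).of_isClosed_subset
      ?_ ?_
    · refine (isClosed_eq (continuous_apply 0) continuous_const).inter ?_
      have hset : {g : ℝ≥0 → X | ∀ s t, dist (g s) (g t) ≤ dist s t}
          = ⋂ s, ⋂ t, {g | dist (g s) (g t) ≤ dist s t} := by
        ext g; simp
      have hclosed : IsClosed {g : ℝ≥0 → X | ∀ s t, dist (g s) (g t) ≤ dist s t} := by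
        rw [hset]
        exact isClosed_iInter fun s => isClosed_iInter fun t =>
          isClosed_le ((continuous_apply s).dist (continuous_apply t)) continuous_const
      exact hclosed
    · rintro g ⟨h0, hg⟩ t -
      have := hg t 0
      rw [h0, NNReal.dist_eq] at this
      simpa using this
  · refine Metric.equicontinuous_of_continuity_modulus id tendsto_id _ ?_
    intro s t c
    simpa using c.2.2.dist_le_mul s t

/-- Points whose Gromov products with a ray tend to infinity converge to the end of the ray. -/
theorem tendsto_ofPoint_ofBoundary [ProperSpace X] {δ : ℝ} (hδ : 0 ≤ δ) (hhyp : IsHyperbolic X δ)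
    (hgeo : IsGeodesicSpace X) (p : X) (ξ : Ray X) {x : ℕ → X}
    (hx : Tendsto (fun n : ℕ × ℝ≥0 => gromovProduct p (x n.1) (ξ.1 n.2)) (atTop ×ˢ atTop) atTop) :
    Tendsto (fun k => GromovClosure.ofPoint p (x k)) atTop
      (𝓝 (GromovClosure.ofBoundary p ξ.atInfinity)) := by
  choose c hlip hgeod hend using fun k => hgeo.exists_generalizedRay p (x k)
  have hpt : ∀ k, GromovClosure.ofPoint p (x k) = (c k).endpoint := fun k => by
    rw [(c k).endpoint_of_stopsAt (hgeod k), hend]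
  simp only [hpt]
  -- Along an ultrafilter the geodesics from `p` to `x k` converge by compactness. It remains to see
  -- that every such limit is a ray asymptotic to `ξ`; the quotient map then carries the convergence
  -- to the closure.
  rw [tendsto_iff_ultrafilter]
  intro U hU
  have hdist : ∀ r : ℝ, ∀ᶠ k in (U : Filter ℕ), r ≤ dist p (x k) := fun r => by
    have h1 := ((tendsto_atTop.1 hx r).curry).filter_mono hU
    filter_upwards [h1] with k hk
    obtain ⟨t, ht⟩ := hk.exists
    refine ht.trans ?_
    unfold gromovProduct
    linarith [dist_triangle p (x k) (ξ.1 t)]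
  obtain ⟨a, ⟨ha0, -⟩, ha⟩ := (isCompact_lipschitz_based p).ultrafilter_le_nhds'
    (U.map fun k => (c k).1)
    (Ultrafilter.mem_map.2 (Filter.univ_mem' fun k => ⟨(c k).2.1, hlip k⟩))
  have ha : Tendsto (fun k => (c k).1) U (𝓝 a) := ha
  have hpoint : ∀ t, Tendsto (fun k => (c k).1 t) U (𝓝 (a t)) := fun t =>
    ((ContinuousEvalConst.continuous_eval_const t).tendsto a).comp ha
  have haiso : Isometry a := by
    refine Isometry.of_dist_eq fun s t => ?_
    refine tendsto_nhds_unique ((hpoint s).dist (hpoint t)) ?_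
    refine tendsto_const_nhds.congr' ?_
    -- The geodesics get arbitrarily long, so eventually both times precede the stopping time.
    filter_upwards [hdist s, hdist t] with k hs ht
    exact ((hgeod k).1 s t (by exact_mod_cast hs) (by exact_mod_cast ht)).symm
  let A : GeneralizedRay X p := ⟨a, ha0, Or.inl haiso⟩
  have hAend : A.endpoint = GromovClosure.ofBoundary p ξ.atInfinity := by
    rw [A.endpoint_of_isometry haiso]
    congr 1
    refine Quotient.sound (s := raySetoid X) ?_
    refine asymptotic_of_le_gromovProduct p (dist p (ξ.1 0) + 2 * δ) fun r => ?_
    have h0 : 0 ≤ dist p (ξ.1 0) := dist_nonneg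
    have hlim : Tendsto (fun k => gromovProduct p ((c k).1 r) (ξ.1 r)) U
        (𝓝 (gromovProduct p (a r) (ξ.1 r))) :=
      (((tendsto_const_nhds.dist (hpoint r)).add tendsto_const_nhds).sub
        ((hpoint r).dist tendsto_const_nhds)).div_const 2
    refine ge_of_tendsto hlim ?_
    -- The chain is `c k r`, `x k`, `ξ t`, `ξ r`, with `t` chosen after `k`.
    filter_upwards [hdist r, ((tendsto_atTop.1 hx r).curry).filter_mono hU] with k hk1 hk2
    obtain ⟨t, ht1, ht2⟩ := (hk2.and (eventually_ge_atTop r)).exists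
    have hr : r ≤ nndist p (x k) := by exact_mod_cast hk1
    have h1 : dist p ((c k).1 r) = r := by
      have := (hgeod k).1 0 r zero_le hr
      rw [(c k).2.1, NNReal.dist_eq] at this
      simpa using this
    have h2 : dist ((c k).1 r) (x k) = dist p (x k) - r := by
      have := (hgeod k).1 r _ hr le_rfl
      rw [hend, NNReal.dist_eq, abs_sub_comm, coe_nndist,
        abs_of_nonneg (sub_nonneg.2 hk1)] at this
      exact this
    have h3 : r - dist p (ξ.1 0) ≤ gromovProduct p ((c k).1 r) (x k) := by
      unfold gromovProduct
      linarith
    have h4 : r - dist p (ξ.1 0) ≤ gromovProduct p (x k) (ξ.1 t) := by linarith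
    have h5 := ξ.le_gromovProduct p ht2
    rw [gromovProduct_comm] at h5
    linarith [hhyp.gromovProduct_ge_of_three h3 h4 h5 hδ]
  have hcA : Tendsto c U (𝓝 A) := tendsto_subtype_rng.2 ha
  rw [← hAend]
  exact ((continuous_coinduced_rng (f := GeneralizedRay.endpoint (p := p))).tendsto A).comp hcA

end Closure

end GromovHyp

/-! ### The main theorem -/

open GromovHyp

theorem theorem1p1 {X : Type*} [MetricSpace X] [ProperSpace X]
    (hgeo : GromovHyp.IsGeodesicSpace X)
    (δ : ℝ) (hδ : 0 ≤ δ) (hhyp : GromovHyp.IsHyperbolic X δ)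
    (hne : Nonempty (GromovHyp.GromovBoundary X))
    (f : X → ℝ) (L : ℝ≥0) (hL : 0 < L) (hLip : LipschitzWith L f)
    (hconv : GromovHyp.IsGeodesicallyConvex f)
    (α : ℝ) (hα : (α : EReal) = -⨅ v : GromovHyp.GromovBoundary X, GromovHyp.asymptoticSlope f v)
    (hαpos : 0 < α) :
    -- the asymptotic slope is a limit along every ray, depending only on the class of the ray
    (∀ ξ : GromovHyp.Ray X,
      Tendsto (fun t : ℝ≥0 => ((f (ξ.1 t) / t : ℝ) : EReal)) atTop
        (𝓝 (GromovHyp.asymptoticSlope f ξ.atInfinity))) ∧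
    ∃ v : GromovHyp.GromovBoundary X,
      -- (i) existence and uniqueness of the negative direction
      (GromovHyp.asymptoticSlope f v < 0 ∧
        ∀ w : GromovHyp.GromovBoundary X, GromovHyp.asymptoticSlope f w < 0 → w = v) ∧
      ∀ (τ : ℝ), 0 < τ → ∀ x : ℕ → X,
        (∀ k : ℕ, x (k + 1) ∈ GromovHyp.proximal f τ (x k)) →
        -- (ii) convergence in the Gromov closure (built from any base point)
        (∀ p : X, Tendsto (fun k : ℕ => GromovHyp.GromovClosure.ofPoint p (x k)) atTop
          (𝓝 (GromovHyp.GromovClosure.ofBoundary p v))) ∧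
        -- (iii) quantitative estimate
        (∀ ξ : GromovHyp.Ray X, ξ.1 0 = x 0 → ξ.atInfinity = v →
          ∀ (k : ℕ) (t : ℝ≥0), 0 < t → f (ξ.1 t) ≤ f (x k) →
            (k : ℝ) * √τ * ((α ^ 2 / (4 * L) + α ^ 4 / (16 * (L : ℝ) ^ 3)) * √τ
                - 2 * √(2 * L * δ))
              ≤ GromovHyp.gromovProduct (x 0) (ξ.1 t) (x k)) := by
  have hslope := exists_asymptoticSlope_eq hδ hhyp hLip hconv
  refine ⟨fun ξ => ?_, ?_⟩
  · obtain ⟨l, hl, hlim⟩ := hslope ξ.atInfinity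
    rw [hl]
    exact (continuous_coe_real_ereal.tendsto l).comp (hlim ξ rfl)
  have hatBot : ∀ v, asymptoticSlope f v < 0 → ∀ ξ : Ray X, ξ.atInfinity = v →
      Tendsto (fun t : ℝ≥0 => f (ξ.1 t)) atTop atBot := fun v hv ξ hξ => by
    obtain ⟨l, hl, hlim⟩ := hslope v
    rw [hl] at hv
    exact tendsto_atBot_of_slope_neg (by exact_mod_cast hv) (hlim ξ hξ)
  have hinf : (⨅ v, asymptoticSlope f v) = ((-α : ℝ) : EReal) := by
    rw [EReal.coe_neg, hα, neg_neg]
  obtain ⟨v, hv⟩ : ∃ v, asymptoticSlope f v < 0 := by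
    refine iInf_lt_iff.1 ?_
    rw [hinf]
    exact_mod_cast neg_lt_zero.2 hαpos
  have huniq : ∀ w, asymptoticSlope f w < 0 → w = v := fun w hw => by
    rw [← Quotient.out_eq w, ← Quotient.out_eq v]
    exact Quotient.sound (s := raySetoid X) (asymptotic_of_tendsto_atBot hδ hhyp hL hLip hconv
      (hatBot w hw _ (Quotient.out_eq w)) (hatBot v hv _ (Quotient.out_eq v)))
  -- All other directions have nonnegative slope, so the infimum is attained at `v`.
  have hvα : asymptoticSlope f v = ((-α : ℝ) : EReal) := by
    rw [← hinf]
    refine le_antisymm (le_iInf fun w => ?_) (iInf_le _ v)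
    rcases lt_or_ge (asymptoticSlope f w) 0 with hw | hw
    · rw [huniq w hw]
    · exact hv.le.trans hw
  have hray : ∀ ξ : Ray X, ξ.atInfinity = v →
      Tendsto (fun t : ℝ≥0 => f (ξ.1 t) / t) atTop (𝓝 (-α)) := fun ξ hξ => by
    obtain ⟨l, hl, hlim⟩ := hslope v
    have : l = -α := by exact_mod_cast hl.symm.trans hvα
    exact this ▸ hlim ξ hξ
  obtain ⟨ζ, hζ⟩ : ∃ ζ : Ray X, ζ.atInfinity = v := ⟨_, Quotient.out_eq v⟩
  have hL' : (0 : ℝ) < L := by exact_mod_cast hL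
  refine ⟨v, ⟨hv, huniq⟩, fun τ hτ x hx => ?_⟩
  set B : ℝ := α ^ 2 / (4 * L) + α ^ 4 / (16 * (L : ℝ) ^ 3) with hB
  have hBpos : 0 < B := by positivity
  have hstep := fun k => proximal_decrease hL hLip hαpos hτ
    (proximal_le hconv hαpos (hray ζ hζ) hτ (hx k))
  have hdecr : ∀ k : ℕ, f (x k) ≤ f (x 0) - k * (2 * L * τ * B) := fun k => by
    induction k with
    | zero => simp
    | succ k ih =>
      have := (hstep k).1
      push_cast
      linarith
  refine ⟨fun p => ?_, fun ξ hξ0 hξ k t _ hft => ?_⟩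
  · have hxbot : Tendsto (fun k => f (x k)) atTop atBot := by
      refine tendsto_atBot_mono hdecr ?_
      have : Tendsto (fun k : ℕ => (k : ℝ) * (2 * L * τ * B)) atTop atTop :=
        tendsto_natCast_atTop_atTop.atTop_mul_const (by positivity)
      simpa only [sub_eq_add_neg, Function.comp_def] using
        tendsto_atBot_add_const_left _ (f (x 0)) (tendsto_neg_atTop_atBot.comp this)
    rw [← hζ]
    exact tendsto_ofPoint_ofBoundary hδ hhyp hgeo p ζ
      (tendsto_gromovProduct_atTop hhyp hL hLip hconv p (hxbot.comp tendsto_fst)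
        ((hatBot v hv ζ hζ).comp tendsto_snd))
  · refine le_of_gain_le_add hL hτ hδ hBpos.le (fun _ => ?_) (gromovProduct_nonneg _ _ _)
      rfl ?_
    -- From `α ≤ L` follows `B ≤ L / 4 + L / 16 ≤ L`.
    · have hαL := (hstep 0).2
      have h1 : α ^ 2 / (4 * L) ≤ (L : ℝ) ^ 2 / (4 * L) := by gcongr
      have h2 : α ^ 4 / (16 * (L : ℝ) ^ 3) ≤ (L : ℝ) ^ 4 / (16 * (L : ℝ) ^ 3) := by gcongr
      have h3 : (L : ℝ) ^ 2 / (4 * L) = L / 4 := by field_simp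
      have h4 : (L : ℝ) ^ 4 / (16 * (L : ℝ) ^ 3) = L / 16 := by field_simp
      linarith
    · have h1 := le_max_add_gromovProduct hhyp hLip hconv (x 0) (ξ.1 t) (x k)
      rw [max_eq_right hft] at h1
      linarith [hdecr k]
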